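/- For a nonempty compact set $F\subset\mathbb R^2$ (Euclidean norm) let $d_F(x):=\operatorname{dist}(x,F)$, $x\in\mathbb R^2$. A point $a\in\mathbb R^2$ is a critical point of $d_F$ if $0$ belongs to the Clarke subdifferential of $d_F$ at $a$, i.e. if $$\limsup_{z\to a,\ t\to 0+}\frac{d_F(z+tv)-d_F(z)}{t}\ \ge\ 0\quad\text{for every } v\in\mathbb R^2,$$ and $\operatorname{cv}(d_F)\subset[0,\infty)$ denotes the set of critical values of $d_F$, i.e. the image under $d_F$ of the set of its critical points. Proposition. Let $D>0$ and $0<\alpha<\beta<\infty$. Then there exists a finite set $P\subset[\alpha,\beta]$ of cardinality exactly $$\left\lfloor 10^{25}\, D^4\,(\beta-\alpha)^{-1}\,\beta^{-3}\right\rfloor+3$$ such that $P\setminus \operatorname{cv}(d_F)\neq\emptyset$ for every nonempty compact set $F\subset\mathbb R^2$ with $\operatorname{diam}F\le D$. -/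

import Mathlib

namespace DistCrit

open Filter Topology

variable {E : Type*} [NormedAddCommGroup E] [NormedSpace ℝ E]

/-- The Clarke derivative `f⁰(a, v)` of a locally Lipschitz function `f : E → ℝ` at `a` in the
direction `v`: the upper limit of `(f (z + t v) - f z) / t` as `z → a` and `t → 0+`.
(The quotients are bounded near `(a, 0)` because `f` is locally Lipschitz, so that the
real-valued upper limit is the genuine one.) -/
noncomputable def clarkeDeriv (f : E → ℝ) (a v : E) : ℝ :=
  limsup (fun p : E × ℝ => (f (p.1 + p.2 • v) - f p.1) / p.2) (𝓝 a ×ˢ 𝓝[>] (0 : ℝ))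

/-- The Clarke subdifferential `∂f(a)`, a set of continuous linear functionals. -/
def clarkeSubdifferential (f : E → ℝ) (a : E) : Set (E →L[ℝ] ℝ) :=
  {φ | ∀ v : E, φ v ≤ clarkeDeriv f a v}

/-- The set of critical points of `f`: those `a` with `0 ∈ ∂f(a)`. -/
def critPoints (f : E → ℝ) : Set E :=
  {a | (0 : E →L[ℝ] ℝ) ∈ clarkeSubdifferential f a}

/-- The set of critical values of `f`. -/
def critValues (f : E → ℝ) : Set ℝ :=
  f '' critPoints f

end DistCrit

namespace DistCrit

open Filter Topology Metric

/-! ### Nearest points at critical points of a distance function. -/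

section InnerProduct

/-! `P` consists of `N` equally spaced values with step `h = L / N`. Were all of them critical,
there would be critical points `x i` with these values. Each has nearest points `p i`, `q i` seen at
an angle of at least `π / 2` (`exists_isNearest_pair`), hence far apart. If two critical points have
close `p`'s and close `q`'s, monotonicity of the nearest point map makes `x i - x j` almost
orthogonal to `p j - q j`, so one coordinate controls it. Critical values `h` apart also force `‖x i
- x j‖ ^ 2 ≥ h * β` (`infDist_sq_le`). Counting grid cells gives `N ≤ C * D ^ 2 / (β * √(h * β))`
(`card_critPoints_le`); squaring and using `N * h = L` bounds `N` by a multiple of `D ^ 4 / ((β - α)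
* β ^ 3)`. -/

/-- `p` is a nearest point to `a` in `F`. -/
def IsNearest {V : Type*} [PseudoMetricSpace V] (F : Set V) (a p : V) : Prop :=
  p ∈ F ∧ dist a p = infDist a F

theorem IsNearest.dist_le {V : Type*} [PseudoMetricSpace V] {F : Set V} {a p q : V}
    (h : IsNearest F a p) (hq : q ∈ F) :
    dist a p ≤ dist a q :=
  h.2.trans_le (infDist_le_dist_of_mem hq)

variable {V : Type*} [NormedAddCommGroup V] [InnerProductSpace ℝ V] {F : Set V}

/-- Difference quotients of a distance function are bounded by the length of the direction. -/
theorem abs_infDist_quotient_le (F : Set V) (z v : V) {t : ℝ} (ht : 0 < t) :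
    |(infDist (z + t • v) F - infDist z F) / t| ≤ ‖v‖ := by
  rw [abs_div, abs_of_pos ht, div_le_iff₀ ht]
  have h := (lipschitz_infDist_pt F).dist_le_mul (z + t • v) z
  rw [Real.dist_eq, dist_eq_norm, add_sub_cancel_left, norm_smul, Real.norm_eq_abs,
    abs_of_pos ht] at h
  simpa [mul_comm] using h

theorem frequently_quotient_gt {a : V} (ha : a ∈ critPoints fun x => infDist x F) (v : V)
    {ε : ℝ} (hε : 0 < ε) :
    ∃ᶠ p : V × ℝ in 𝓝 a ×ˢ 𝓝[>] (0 : ℝ),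
      -ε < (infDist (p.1 + p.2 • v) F - infDist p.1 F) / p.2 := by
  have h0 : 0 ≤ clarkeDeriv (fun x => infDist x F) a v := ha v
  have hev : ∀ᶠ p : V × ℝ in 𝓝 a ×ˢ 𝓝[>] (0 : ℝ), 0 < p.2 :=
    tendsto_snd.eventually self_mem_nhdsWithin
  -- A real `limsup` is meaningful only under coboundedness, which the Lipschitz bound supplies.
  refine frequently_lt_of_lt_limsup (IsCoboundedUnder.of_frequently_ge (a := -‖v‖) ?_)
    (lt_of_lt_of_le (neg_neg_of_pos hε) h0)
  exact (hev.mono fun p hp => (abs_le.1 (abs_infDist_quotient_le F p.1 v hp)).1).frequently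

/-- The point `p` still competes at `z + t • v`; expand the square of its distance and divide by
`t`. -/
theorem inner_le_of_quotient_gt {z p v : V} {t ε : ℝ} (hp : IsNearest F z p) (ht : 0 < t)
    (h : -ε < (infDist (z + t • v) F - infDist z F) / t) :
    2 * inner ℝ (p - z) v ≤
      t * ‖v‖ ^ 2 + ε * (infDist (z + t • v) F + infDist z F) := by
  rw [lt_div_iff₀ ht] at h
  set d := infDist z F with hd
  set d' := infDist (z + t • v) F
  have hd0 : 0 ≤ d := infDist_nonneg
  have hd0' : 0 ≤ d' := infDist_nonneg
  have h1 : d' ≤ ‖(z - p) + t • v‖ := by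
    have := infDist_le_dist_of_mem (x := z + t • v) hp.1
    rwa [dist_eq_norm, show z + t • v - p = (z - p) + t • v by abel] at this
  have h2 : d' ^ 2 ≤ ‖(z - p) + t • v‖ ^ 2 := by gcongr
  have h3 : ‖z - p‖ = d := by rw [← dist_eq_norm]; exact hp.2
  rw [norm_add_sq_real, h3, inner_smul_right, norm_smul, Real.norm_eq_abs, abs_of_pos ht,
    ← neg_sub p z, inner_neg_left] at h2
  have h4 : -ε * t * (d' + d) ≤ (d' - d) * (d' + d) :=
    mul_le_mul_of_nonneg_right h.le (by positivity)
  refine le_of_mul_le_mul_left ?_ ht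
  nlinarith

/-- At a critical point of a distance function, every direction is at an angle of at least
`π / 2` to the direction of some nearest point. -/
theorem exists_isNearest_inner_nonpos (hF : IsCompact F) (hne : F.Nonempty) {a : V}
    (ha : a ∈ critPoints fun x => infDist x F) (v : V) :
    ∃ p, IsNearest F a p ∧ inner ℝ (p - a) v ≤ 0 := by
  have hseq : ∀ n : ℕ, ∃ z : V, ∃ t : ℝ, dist z a < 1 / ((n : ℝ) + 1) ∧ 0 < t ∧
      t < 1 / ((n : ℝ) + 1) ∧
      -(1 / ((n : ℝ) + 1)) < (infDist (z + t • v) F - infDist z F) / t := by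
    intro n
    have hn : (0 : ℝ) < 1 / ((n : ℝ) + 1) := Nat.one_div_pos_of_nat
    have hev : ∀ᶠ p : V × ℝ in 𝓝 a ×ˢ 𝓝[>] (0 : ℝ),
        dist p.1 a < 1 / ((n : ℝ) + 1) ∧ p.2 ∈ Set.Ioo 0 (1 / ((n : ℝ) + 1)) :=
      (tendsto_fst.eventually (ball_mem_nhds a hn)).and
        (tendsto_snd.eventually (Ioo_mem_nhdsGT hn))
    obtain ⟨p, h1, h2, h3⟩ := ((frequently_quotient_gt ha v hn).and_eventually hev).exists
    exact ⟨p.1, p.2, h2, h3.1, h3.2, h1⟩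
  choose z t hz ht ht' hq using hseq
  have hnear : ∀ n, ∃ p, IsNearest F (z n) p := fun n => by
    obtain ⟨p, hp, hd⟩ := hF.exists_infDist_eq_dist hne (z n)
    exact ⟨p, hp, hd.symm⟩
  choose p hp using hnear
  obtain ⟨b, hb, φ, hφ, hlim⟩ := hF.tendsto_subseq fun n => (hp n).1
  have he : Tendsto (fun n => 1 / (((φ n : ℕ) : ℝ) + 1)) atTop (𝓝 0) :=
    tendsto_one_div_add_atTop_nhds_zero_nat.comp hφ.tendsto_atTop
  have hzlim : Tendsto (fun n => z (φ n)) atTop (𝓝 a) :=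
    tendsto_iff_dist_tendsto_zero.2
      (squeeze_zero (fun _ => dist_nonneg) (fun n => (hz (φ n)).le) he)
  have htlim : Tendsto (fun n => t (φ n)) atTop (𝓝 0) :=
    squeeze_zero (fun n => (ht (φ n)).le) (fun n => (ht' (φ n)).le) he
  have hc : Continuous fun x => infDist x F := continuous_infDist_pt F
  have hd : Tendsto (fun n => infDist (z (φ n)) F) atTop (𝓝 (infDist a F)) :=
    (hc.tendsto a).comp hzlim
  have hd' : Tendsto (fun n => infDist (z (φ n) + t (φ n) • v) F) atTop
      (𝓝 (infDist (a + (0 : ℝ) • v) F)) :=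
    (hc.tendsto _).comp (hzlim.add (htlim.smul_const v))
  refine ⟨b, ⟨hb, ?_⟩, ?_⟩
  · refine tendsto_nhds_unique (hzlim.dist hlim) (hd.congr fun n => ?_)
    exact (hp (φ n)).2.symm
  · have hl := (Tendsto.inner (𝕜 := ℝ) (hlim.sub hzlim)
      (tendsto_const_nhds (x := v))).const_mul (2 : ℝ)
    have hr := (htlim.mul_const (‖v‖ ^ 2)).add (he.mul (hd'.add hd))
    have := le_of_tendsto_of_tendsto' hl hr fun n =>
      inner_le_of_quotient_gt (hp (φ n)) (ht (φ n)) (hq (φ n))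
    simp only [zero_mul, add_zero] at this
    linarith

theorem exists_isNearest_pair (hF : IsCompact F) (hne : F.Nonempty) {a : V}
    (ha : a ∈ critPoints fun x => infDist x F) :
    ∃ p q, IsNearest F a p ∧ IsNearest F a q ∧ inner ℝ (p - a) (q - a) ≤ 0 := by
  -- Direction `0` only serves to produce some nearest point.
  obtain ⟨p, hp, -⟩ := exists_isNearest_inner_nonpos hF hne ha 0
  obtain ⟨q, hq, h⟩ := exists_isNearest_inner_nonpos hF hne ha (p - a)
  exact ⟨p, q, hp, hq, by rwa [real_inner_comm]⟩

/-- Some nearest point to `a` lies at an angle of at most `π / 2` to `b - a`, so the law of cosines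
at `a` gives the bound. The increase is only quadratic in `‖b - a‖`, whence the square root in the
count. -/
theorem infDist_sq_le (hF : IsCompact F) (hne : F.Nonempty) {a : V}
    (ha : a ∈ critPoints fun x => infDist x F) (b : V) :
    infDist b F ^ 2 ≤ infDist a F ^ 2 + ‖b - a‖ ^ 2 := by
  obtain ⟨p, hp, h⟩ := exists_isNearest_inner_nonpos hF hne ha (a - b)
  have h1 : infDist b F ≤ ‖(p - a) + (a - b)‖ := by
    have := infDist_le_dist_of_mem (x := b) hp.1
    rwa [dist_comm, dist_eq_norm, ← sub_add_sub_cancel p a b] at this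
  have h2 : infDist b F ^ 2 ≤ ‖(p - a) + (a - b)‖ ^ 2 := by
    gcongr
    exact infDist_nonneg
  have h3 : ‖p - a‖ = infDist a F := by rw [← dist_eq_norm, dist_comm]; exact hp.2
  rw [norm_add_sq_real, h3, norm_sub_rev a b] at h2
  linarith

theorem two_mul_infDist_sq_le {a p q : V} (hp : IsNearest F a p) (hq : IsNearest F a q)
    (h : inner ℝ (p - a) (q - a) ≤ 0) : 2 * infDist a F ^ 2 ≤ ‖p - q‖ ^ 2 := by
  have h3 : ‖p - a‖ = infDist a F := by rw [← dist_eq_norm, dist_comm]; exact hp.2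
  have h4 : ‖q - a‖ = infDist a F := by rw [← dist_eq_norm, dist_comm]; exact hq.2
  rw [← sub_sub_sub_cancel_right p q a, norm_sub_sq_real, h3, h4]
  linarith

/-- The nearest point map is monotone. -/
theorem inner_isNearest_nonneg {x y p q : V} (hp : IsNearest F x p) (hq : IsNearest F y q) :
    0 ≤ inner ℝ (x - y) (p - q) := by
  have h1 : ‖x - p‖ ^ 2 ≤ ‖x - q‖ ^ 2 := by
    have := hp.dist_le hq.1
    rw [dist_eq_norm, dist_eq_norm] at this
    gcongr
  have h2 : ‖y - q‖ ^ 2 ≤ ‖y - p‖ ^ 2 := by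
    have := hq.dist_le hp.1
    rw [dist_eq_norm, dist_eq_norm] at this
    gcongr
  rw [norm_sub_sq_real, norm_sub_sq_real] at h1 h2
  simp only [inner_sub_left, inner_sub_right]
  linarith

/-- Monotonicity for the crossed pairs `(p, q')` and `(q, p')` gives the two signs. -/
theorem abs_inner_isNearest_le {x y p q p' q' : V} {η : ℝ} (hp : IsNearest F x p)
    (hq : IsNearest F x q) (hp' : IsNearest F y p') (hq' : IsNearest F y q')
    (h1 : ‖p - p'‖ ≤ η) (h2 : ‖q - q'‖ ≤ η) :
    |inner ℝ (x - y) (p' - q')| ≤ ‖x - y‖ * η := by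
  have e1 := inner_isNearest_nonneg hp hq'
  have e2 := inner_isNearest_nonneg hq hp'
  have f1 := (real_inner_le_norm (x - y) (p - p')).trans
    (mul_le_mul_of_nonneg_left h1 (norm_nonneg _))
  have f2 := (real_inner_le_norm (x - y) (q - q')).trans
    (mul_le_mul_of_nonneg_left h2 (norm_nonneg _))
  simp only [inner_sub_right] at *
  rw [abs_le]
  constructor <;> linarith

end InnerProduct

end DistCrit

namespace DistCrit

open Metric

/-! ### Counting critical points in the plane. -/

section Plane

local notation "ℝ²" => EuclideanSpace ℝ (Fin 2)

/-- The dominant coordinate satisfies `|c| ≥ β / 2`, so near-orthogonality yields `|a| ≤ 3 * |b|`.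
-/
theorem norm_sq_le_of_abs_inner_le {a b c d n β : ℝ} (hn : 0 ≤ n) (hn2 : n ^ 2 = a ^ 2 + b ^ 2)
    (hβ : 0 < β) (hdc : |d| ≤ |c|) (hw : β ^ 2 / 2 ≤ c ^ 2 + d ^ 2)
    (h : |a * c + b * d| ≤ n * (β / 4)) : n ^ 2 ≤ 10 * b ^ 2 := by
  have hd2 : d ^ 2 ≤ c ^ 2 := sq_le_sq.2 hdc
  have hc : β / 2 ≤ |c| := by
    refine le_of_sq_le_sq ?_ (abs_nonneg c)
    rw [sq_abs]
    linarith
  have hc0 : 0 < |c| := by linarith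
  have hna : n ≤ |a| + |b| := by
    refine le_of_sq_le_sq ?_ (by positivity)
    rw [hn2, ← sq_abs a, ← sq_abs b]
    nlinarith [abs_nonneg a, abs_nonneg b]
  have h1 : |a| * |c| ≤ |b| * |c| + (|a| + |b|) * (|c| / 2) := by
    calc |a| * |c| = |(a * c + b * d) - b * d| := by rw [add_sub_cancel_right, abs_mul]
      _ ≤ |a * c + b * d| + |b * d| := abs_sub _ _
      _ ≤ n * (β / 4) + |b| * |d| := by rw [abs_mul b d]; gcongr
      _ ≤ (|a| + |b|) * (|c| / 2) + |b| * |c| :=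
        add_le_add (mul_le_mul hna (by linarith) (by positivity) (by positivity)) (by gcongr)
      _ = _ := add_comm _ _
  have h2 : |a| ≤ 3 * |b| := by
    refine le_of_mul_le_mul_right ?_ hc0
    linarith
  have h3 : a ^ 2 ≤ 9 * b ^ 2 := by
    rw [← sq_abs a, ← sq_abs b]
    nlinarith [abs_nonneg a, abs_nonneg b]
  linarith

/-- A vector that is nearly orthogonal to `w` is controlled by one coordinate, which depends only
on `w`. -/
theorem exists_coord_norm_sq_le {β : ℝ} (hβ : 0 < β) {w : ℝ²} (hw : β ^ 2 / 2 ≤ ‖w‖ ^ 2) :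
    ∃ k : Fin 2, ∀ u : ℝ², |inner ℝ u w| ≤ ‖u‖ * (β / 4) → ‖u‖ ^ 2 ≤ 10 * u k ^ 2 := by
  have hin : ∀ u : ℝ², inner ℝ u w = u 0 * w 0 + u 1 * w 1 := fun u => by
    simp [PiLp.inner_apply, Fin.sum_univ_two, mul_comm]
  have hnorm : ∀ u : ℝ², ‖u‖ ^ 2 = u 0 ^ 2 + u 1 ^ 2 := fun u => by
    simp [EuclideanSpace.real_norm_sq_eq, Fin.sum_univ_two]
  rw [hnorm] at hw
  rcases le_total |w 1| |w 0| with h | h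
  · refine ⟨1, fun u hu => ?_⟩
    rw [hin] at hu
    exact norm_sq_le_of_abs_inner_le (norm_nonneg u) (hnorm u) hβ h hw hu
  · refine ⟨0, fun u hu => ?_⟩
    rw [hin, add_comm] at hu
    rw [add_comm] at hw
    exact norm_sq_le_of_abs_inner_le (norm_nonneg u) ((hnorm u).trans (add_comm _ _)) hβ h hw hu

theorem abs_sub_lt_of_floor_div_eq {a b η : ℝ} (hη : 0 < η) (h : ⌊a / η⌋ = ⌊b / η⌋) :
    |a - b| < η := by
  have := Int.abs_sub_lt_one_of_floor_eq_floor h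
  rwa [← sub_div, abs_div, abs_of_pos hη, div_lt_one hη] at this

theorem floor_mem_Icc_ceil {y Y : ℝ} (h : |y| ≤ Y) : ⌊y⌋ ∈ Finset.Icc (-⌈Y⌉) ⌈Y⌉ := by
  have h' := abs_le.1 h
  rw [Finset.mem_Icc]
  constructor
  · rw [Int.le_floor, Int.cast_neg]
    linarith [Int.le_ceil Y]
  · exact_mod_cast (Int.floor_le y).trans (h'.2.trans (Int.le_ceil Y))

theorem card_Icc_ceil_le {Y : ℝ} (hY : 0 ≤ Y) :
    ((Finset.Icc (-⌈Y⌉) ⌈Y⌉).card : ℝ) ≤ 2 * Y + 3 := by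
  have h0 : 0 ≤ ⌈Y⌉ := Int.ceil_nonneg hY
  have h1 : ((Finset.Icc (-⌈Y⌉) ⌈Y⌉).card : ℤ) = 2 * ⌈Y⌉ + 1 := by
    rw [Int.card_Icc]
    omega
  have h2 : ((Finset.Icc (-⌈Y⌉) ⌈Y⌉).card : ℝ) = 2 * ⌈Y⌉ + 1 := by exact_mod_cast h1
  rw [h2]
  linarith [Int.ceil_lt_add_one Y]

/-- A family of critical points with separated values is bounded in number. -/
theorem card_critPoints_le {F : Set ℝ²} (hF : IsCompact F) (hne : F.Nonempty) {D β h : ℝ}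
    (hD : diam F ≤ D) (hβ : 0 < β) (hβD : β ≤ D) (hh : 0 < h) (hhβ : h ≤ β)
    {ι : Type*} [Fintype ι] (x : ι → ℝ²)
    (hx : ∀ i, x i ∈ critPoints fun y => infDist y F)
    (hlow : ∀ i, β / 2 ≤ infDist (x i) F) (hup : ∀ i, infDist (x i) F ≤ β)
    (hsep : ∀ i j, i ≠ j → h ≤ |infDist (x i) F - infDist (x j) F|) :
    (Fintype.card ι : ℝ) ≤ 2 * 10 ^ 7 * D ^ 2 / (β * √(h * β)) := by
  classical
  have hD0 : 0 < D := hβ.trans_le hβD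
  obtain ⟨f, hf⟩ := hne
  have hpair := fun i => exists_isNearest_pair hF ⟨f, hf⟩ (hx i)
  choose p q hp hq hpq using hpair
  have hk : ∀ i, ∃ k : Fin 2, ∀ u : ℝ²,
      |inner ℝ u (p i - q i)| ≤ ‖u‖ * (β / 4) → ‖u‖ ^ 2 ≤ 10 * u k ^ 2 := fun i =>
    exists_coord_norm_sq_le hβ (by
      have h1 := two_mul_infDist_sq_le (hp i) (hq i) (hpq i)
      nlinarith [hlow i])
  choose k hk using hk
  -- Points in a common cell of side `η` are within `√2 * β / 8 ≤ β / 4`.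
  set η := β / 8 with hη
  have hη0 : 0 < η := by positivity
  set σ := √(h * β) / 4 with hσ
  have hσ0 : 0 < σ := by positivity
  have hσ2 : 16 * σ ^ 2 = h * β := by
    rw [hσ, div_pow, Real.sq_sqrt (by positivity)]
    ring
  let g : ℝ² → Fin 2 → ℤ := fun y l => ⌊(y l - f l) / η⌋
  let r : ι → ℝ := fun i => x i (k i) - f (k i) - η * g (p i) (k i)
  -- The cell of `q i` and the coordinate of `x i` are recorded relative to the cell of `p i`: only
  -- that cell then costs a factor `(D / β) ^ 2`.
  let code : ι → ℤ × ℤ × ℤ × ℤ × Fin 2 × ℤ := fun i =>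
    (g (p i) 0, g (p i) 1, g (q i) 0 - g (p i) 0, g (q i) 1 - g (p i) 1, k i, ⌊r i / σ⌋)
  have hcoord : ∀ (u : ℝ²) (l : Fin 2), |u l| ≤ ‖u‖ := fun u l => PiLp.norm_apply_le u l
  have hnear : ∀ y z : ℝ², g y 0 = g z 0 → g y 1 = g z 1 → ‖y - z‖ ≤ β / 4 := by
    intro y z h0 h1
    have e0 := abs_sub_lt_of_floor_div_eq hη0 h0
    have e1 := abs_sub_lt_of_floor_div_eq hη0 h1
    rw [sub_sub_sub_cancel_right] at e0 e1
    refine le_of_sq_le_sq ?_ (by positivity)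
    rw [EuclideanSpace.real_norm_sq_eq, Fin.sum_univ_two, PiLp.sub_apply, PiLp.sub_apply,
      ← sq_abs (y 0 - z 0), ← sq_abs (y 1 - z 1)]
    nlinarith [abs_nonneg (y 0 - z 0), abs_nonneg (y 1 - z 1)]
  have hinj : Function.Injective code := by
    intro i j hij
    simp only [code, Prod.mk.injEq] at hij
    obtain ⟨a0, a1, b0, b1, hkk, hr⟩ := hij
    by_contra hne
    have hin := abs_inner_isNearest_le (hp i) (hq i) (hp j) (hq j) (hnear _ _ a0 a1)
      (hnear _ _ (by omega) (by omega))
    have h10 := hk j _ hin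
    have hru : r i - r j = (x i - x j) (k j) := by
      have hg : g (p i) (k j) = g (p j) (k j) := by
        generalize k j = l
        fin_cases l
        exacts [a0, a1]
      simp only [r, hkk, hg, PiLp.sub_apply]
      ring
    have hlt := abs_sub_lt_of_floor_div_eq hσ0 hr
    rw [hru] at hlt
    have hlt2 : (x i - x j) (k j) ^ 2 < σ ^ 2 := by
      rw [← sq_abs]
      gcongr
    have d1 := infDist_sq_le hF ⟨f, hf⟩ (hx i) (x j)
    have d2 := infDist_sq_le hF ⟨f, hf⟩ (hx j) (x i)
    rw [norm_sub_rev] at d1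
    have hs := hsep i j hne
    have li := hlow i
    have lj := hlow j
    have hb : h * β ≤ ‖x i - x j‖ ^ 2 := by
      rcases le_abs.1 hs with hs | hs <;> nlinarith
    -- Contradiction: `‖x i - x j‖ ^ 2 < 10 * σ ^ 2 < 16 * σ ^ 2 = h * β`.
    nlinarith
  have hfD : ∀ y ∈ F, ∀ l, |(y l - f l) / η| ≤ 8 * D / β := by
    intro y hy l
    rw [abs_div, abs_of_pos hη0, div_le_div_iff₀ hη0 hβ, hη]
    have h1 := (hcoord (y - f) l).trans
      ((dist_eq_norm y f).symm.trans_le ((dist_le_diam_of_mem hF.isBounded hy hf).trans hD))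
    rw [PiLp.sub_apply] at h1
    nlinarith
  have hxp : ∀ i l, |x i l - p i l| ≤ β := fun i l =>
    (hcoord (x i - p i) l).trans ((dist_eq_norm (x i) (p i)).symm.trans_le
      ((hp i).2.trans_le (hup i)))
  have hxq : ∀ i l, |x i l - q i l| ≤ β := fun i l =>
    (hcoord (x i - q i) l).trans ((dist_eq_norm (x i) (q i)).symm.trans_le
      ((hq i).2.trans_le (hup i)))
  have hfl : ∀ (y : ℝ²) (l : Fin 2), η * g y l ≤ y l - f l ∧ y l - f l < η * g y l + η := by
    intro y l
    have h1 := Int.floor_le ((y l - f l) / η)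
    have h2 := Int.lt_floor_add_one ((y l - f l) / η)
    rw [le_div_iff₀ hη0] at h1
    rw [div_lt_iff₀ hη0] at h2
    constructor <;> simp only [g] <;> linarith
  -- Coordinates of `p i` and `q i` differ by at most `2 * β = 16 * η`.
  have hgg : ∀ i l, g (q i) l - g (p i) l ∈ Finset.Icc (-17 : ℤ) 17 := by
    intro i l
    have h1 := abs_le.1 (hxp i l)
    have h2 := abs_le.1 (hxq i l)
    have h3 := hfl (p i) l
    have h4 := hfl (q i) l
    have hβη : β = 8 * η := by rw [hη]; ring
    rw [Finset.mem_Icc]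
    constructor
    · have : (-18 : ℝ) < g (q i) l - g (p i) l := by
        refine lt_of_mul_lt_mul_left ?_ hη0.le
        linarith
      have : (-18 : ℤ) < g (q i) l - g (p i) l := by exact_mod_cast this
      omega
    · have : (g (q i) l - g (p i) l : ℝ) < 18 := by
        refine lt_of_mul_lt_mul_left ?_ hη0.le
        linarith
      have : g (q i) l - g (p i) l < 18 := by exact_mod_cast this
      omega
  have hrb : ∀ i, |r i / σ| ≤ 9 / 8 * β / σ := by
    intro i
    have h1 := abs_le.1 (hxp i (k i))
    have h3 := hfl (p i) (k i)
    rw [abs_div, abs_of_pos hσ0]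
    gcongr
    rw [abs_le]
    simp only [r]
    constructor <;> linarith
  let A := Finset.Icc (-⌈8 * D / β⌉) ⌈8 * D / β⌉
  let B := Finset.Icc (-17 : ℤ) 17
  let C := Finset.Icc (-⌈9 / 8 * β / σ⌉) ⌈9 / 8 * β / σ⌉
  have hcard : Fintype.card ι ≤ (A ×ˢ A ×ˢ B ×ˢ B ×ˢ (Finset.univ : Finset (Fin 2)) ×ˢ C).card := by
    rw [← Finset.card_univ]
    refine Finset.card_le_card_of_injOn code (fun i _ => ?_) hinj.injOn
    simp only [code, Finset.coe_product, Set.mem_prod, Finset.mem_coe]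
    exact ⟨floor_mem_Icc_ceil (hfD _ (hp i).1 0), floor_mem_Icc_ceil (hfD _ (hp i).1 1),
      hgg i 0, hgg i 1, Finset.mem_univ _, floor_mem_Icc_ceil (hrb i)⟩
  have hB : B.card = 35 := by simp [B]
  simp only [Finset.card_product, hB, Finset.card_univ, Fintype.card_fin] at hcard
  have hs0 : 0 < √(h * β) := by positivity
  have hsβ : √(h * β) ≤ β := Real.sqrt_le_iff.2 ⟨hβ.le, by nlinarith⟩
  have hA : (A.card : ℝ) ≤ 19 * (D / β) := by
    have h1 := card_Icc_ceil_le (Y := 8 * D / β) (by positivity)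
    have h2 : 1 ≤ D / β := (one_le_div hβ).2 hβD
    rw [mul_div_assoc] at h1
    simp only [A, mul_div_assoc]
    linarith
  have hC : (C.card : ℝ) ≤ 12 * (β / √(h * β)) := by
    have h1 := card_Icc_ceil_le (Y := 9 / 8 * β / σ) (by positivity)
    have h2 : 1 ≤ β / √(h * β) := (one_le_div hs0).2 hsβ
    have h3 : 9 / 8 * β / σ = 9 / 2 * (β / √(h * β)) := by
      rw [hσ]
      field_simp
      norm_num
    rw [h3] at h1
    simp only [C, h3]
    linarith
  calc (Fintype.card ι : ℝ)
      ≤ ((A.card * (A.card * (35 * (35 * (2 * C.card)))) : ℕ) : ℝ) := by exact_mod_cast hcard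
    _ = 2450 * (A.card * A.card * C.card) := by push_cast; ring
    _ ≤ 2450 * (19 * (D / β) * (19 * (D / β)) * (12 * (β / √(h * β)))) := by
        gcongr
    _ = 10613400 * D ^ 2 / (β * √(h * β)) := by
        field_simp
        ring
    _ ≤ 2 * 10 ^ 7 * D ^ 2 / (β * √(h * β)) := by
        gcongr
        norm_num

theorem le_of_mem_critValues {F : Set ℝ²} (hF : IsCompact F) (hne : F.Nonempty) {D β : ℝ}
    (hD : diam F ≤ D) (hβ : 0 < β) (h : β ∈ critValues fun x => infDist x F) : β ≤ D := by
  obtain ⟨a, ha, rfl⟩ := h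
  obtain ⟨p, q, hp, hq, hpq⟩ := exists_isNearest_pair hF hne ha
  have h1 := two_mul_infDist_sq_le hp hq hpq
  have h2 := (dist_eq_norm p q).symm.trans_le
    ((dist_le_diam_of_mem hF.isBounded hp.1 hq.1).trans hD)
  refine le_trans (le_of_sq_le_sq ?_ (norm_nonneg _)) h2
  nlinarith [sq_nonneg (infDist a F)]

end Plane

end DistCrit

/-! ### The set of equally spaced values. -/

theorem mainTheorem11 (D α β : ℝ) (hD : 0 < D) (hα : 0 < α) (hαβ : α < β) :
    ∃ P : Finset ℝ,
      (P : Set ℝ) ⊆ Set.Icc α β ∧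
      P.card = ⌊(10 : ℝ) ^ 25 * D ^ 4 * (β - α)⁻¹ * β ^ (-3 : ℤ)⌋₊ + 3 ∧
      ∀ F : Set (EuclideanSpace ℝ (Fin 2)), IsCompact F → F.Nonempty → Metric.diam F ≤ D →
        ((P : Set ℝ) \ DistCrit.critValues (fun x => Metric.infDist x F)).Nonempty := by
  have hβ : 0 < β := hα.trans hαβ
  set N := ⌊(10 : ℝ) ^ 25 * D ^ 4 * (β - α)⁻¹ * β ^ (-3 : ℤ)⌋₊ + 3 with hN
  have hN0 : (0 : ℝ) < N := by positivity
  have hNlt : (10 : ℝ) ^ 25 * D ^ 4 * (β - α)⁻¹ * β ^ (-3 : ℤ) < N := by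
    rw [hN]
    push_cast
    linarith [Nat.lt_floor_add_one ((10 : ℝ) ^ 25 * D ^ 4 * (β - α)⁻¹ * β ^ (-3 : ℤ))]
  -- The cap `β / 2` keeps all values in `[β / 2, β]` and costs at most a factor 2.
  set L := min (β - α) (β / 2) with hL
  have hL0 : 0 < L := lt_min (by linarith) (by linarith)
  have hLα : L ≤ β - α := min_le_left _ _
  have hLβ : L ≤ β / 2 := min_le_right _ _
  have hL2 : (β - α) / 2 ≤ L := le_min (by linarith) (by linarith)
  set h := L / N with hh
  have hh0 : 0 < h := by positivity
  have hNh : N * h = L := by rw [hh]; field_simp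
  have hih : ∀ i : Fin N, 0 ≤ (i : ℝ) * h ∧ (i : ℝ) * h ≤ L := fun i => by
    refine ⟨by positivity, hNh ▸ ?_⟩
    gcongr
    exact i.2.le
  have hinj : Function.Injective fun i : Fin N => β - (i : ℝ) * h := by
    intro i j hij
    have := mul_right_cancel₀ hh0.ne' (sub_right_injective hij)
    exact Fin.ext (by exact_mod_cast this)
  refine ⟨Finset.univ.map ⟨_, hinj⟩, ?_, by simp, fun F hF hne hdiam => ?_⟩
  · intro y hy
    simp only [Finset.coe_map, Function.Embedding.coeFn_mk, Finset.coe_univ, Set.image_univ,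
      Set.mem_range] at hy
    obtain ⟨i, rfl⟩ := hy
    have := hih i
    constructor <;> linarith
  · rw [Set.nonempty_iff_ne_empty, Ne, Set.sdiff_eq_empty]
    intro hsub
    have hcv : ∀ i : Fin N, β - (i : ℝ) * h ∈
        DistCrit.critValues fun x => Metric.infDist x F := fun i =>
      hsub (Finset.mem_coe.2 (Finset.mem_map_of_mem _ (Finset.mem_univ i)))
    -- The index `0` makes `β` itself a critical value.
    have hβD : β ≤ D := DistCrit.le_of_mem_critValues hF hne hdiam hβ (by
      simpa using hcv ⟨0, by omega⟩)
    choose x hx hxv using hcv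
    simp only at hxv
    have hhβ : h ≤ β := by
      have h1 : 1 * h ≤ N * h := by
        gcongr
        exact_mod_cast (by omega : 1 ≤ N)
      linarith
    have key := DistCrit.card_critPoints_le hF hne hdiam hβ hβD hh0 hhβ x hx
      (fun i => by rw [hxv]; linarith [(hih i).2])
      (fun i => by rw [hxv]; linarith [(hih i).1])
      (fun i j hij => by
        rw [hxv, hxv, sub_sub_sub_cancel_left, ← sub_mul, abs_mul, abs_of_pos hh0]
        refine le_mul_of_one_le_left hh0.le ?_
        have hz : (j : ℤ) - (i : ℤ) ≠ 0 := by
          have := Fin.val_ne_of_ne hij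
          omega
        exact_mod_cast Int.one_le_abs hz)
    rw [Fintype.card_fin, le_div_iff₀ (by positivity)] at key
    -- After squaring, `h = L / N` cancels one factor `N`; the result `N ≤ 8 * 10 ^ 14 * D ^ 4 / ((β
    -- - α) * β ^ 3)` is far below the threshold `10 ^ 25`.
    have key2 : (N * (β * √(h * β))) ^ 2 ≤ (2 * 10 ^ 7 * D ^ 2) ^ 2 := by gcongr
    have e1 : (N * (β * √(h * β))) ^ 2 = N * L * β ^ 3 := by
      rw [mul_pow, mul_pow, Real.sq_sqrt (by positivity), ← hNh]
      ring
    rw [e1] at key2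
    have hd : 0 < β - α := by linarith
    have e2 : (10 : ℝ) ^ 25 * D ^ 4 * (β - α)⁻¹ * β ^ (-3 : ℤ) =
        10 ^ 25 * D ^ 4 / ((β - α) * β ^ 3) := by
      rw [zpow_neg, div_eq_mul_inv, mul_inv, ← mul_assoc]
      norm_cast
    rw [e2, div_lt_iff₀ (by positivity)] at hNlt
    have e3 : N * ((β - α) / 2) * β ^ 3 ≤ N * L * β ^ 3 := by gcongr
    have hD4 : 0 < D ^ 4 := by positivity
    nlinarith
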